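/- All dg-algebras are over an arbitrary commutative base ring $R$: $\mathbb Z$-graded $R$-algebras $A$ with an $R$-linear differential $d_A$ of degree $+1$, $d_A^2=0$ and $d_A(ab)=d_A(a)b+(-1)^{|a|}a\,d_A(b)$ for homogeneous $a$. A dg-module is a $\mathbb Z$-graded left $A$-module $M$ with $\delta$ of degree $+1$, $\delta^2=0$ and $\delta(am)=d_A(a)m+(-1)^{|a|}a\,\delta(m)$; morphisms of dg-modules are the $A$-linear maps of degree $0$ commuting with the differentials. A dg-algebra is acyclic if its homology is $0$, and a dg-division ring if its only dg-left ideals (homogeneous, $d$-stable left ideals) and its only dg-right ideals are $0$ and the whole ring. It is graded commutative if $xy=(-1)^{|x||y|}yx$ for homogeneous $x,y$. A homomorphism of dg-algebras $\varphi:(K,d_K)\to(A,d_A)$ (that is, a dg-extension) is dg-separable if the multiplication map $A\otimes_KA\to A$ is split by a morphism of differential graded $A$-$A$-bimodules, where $A\otimes_KA$ has the differential $a\otimes b\mapsto d_A(a)\otimes b+(-1)^{|a|}a\otimes d_A(b)$. Let $(K,d_K)$ be a graded commutative acyclic dg-division ring, let $(A,d_A)$ be an acyclic dg-algebra and let $\varphi:(K,d_K)\to(A,d_A)$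 be a dg-separable dg-extension. Then every dg-module over $(A,d_A)$ is a projective object of the category of dg-modules over $(A,d_A)$. If moreover $(A,d_A)$ is dg-artinian and dg-Noetherian (descending and ascending chain condition on dg-left ideals), then the category of dg-modules over $(A,d_A)$ is semisimple: every short exact sequence of dg-modules splits, and every dg-module is a direct sum of simple dg-modules. Moreover, $\ker(d_A)$ is graded-semisimple: every $\mathbb Z$-graded left $\ker(d_A)$-module is a direct sum of gr-simple graded modules. -/

import Mathlib

open CategoryTheory
open scoped TensorProduct

universe u₀ u u' v w

/-- A differential graded algebra over the commutative ring `R`: a `ℤ`-graded `R`-algebra with an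
`R`-linear endomorphism `d` of degree `1` such that `d² = 0` and
`d (a b) = d a * b + (-1) ^ |a| * a * d b`. -/
structure DGAlgebra (R : Type u₀) [CommRing R] where
  carrier : Type u
  [ring : Ring carrier]
  [algebra : Algebra R carrier]
  /-- the homogeneous components -/
  grading : ℤ → Submodule R carrier
  [graded : GradedAlgebra grading]
  /-- the differential -/
  d : carrier →ₗ[R] carrier
  d_mem : ∀ {i : ℤ} {a : carrier}, a ∈ grading i → d a ∈ grading (i + 1)
  d_d : ∀ a : carrier, d (d a) = 0
  leibniz : ∀ {i : ℤ} {a : carrier}, a ∈ grading i → ∀ b : carrier,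
    d (a * b) = d a * b + i.negOnePow • (a * d b)

namespace DGAlgebra

variable {R : Type u₀} [CommRing R]

instance : CoeSort (DGAlgebra.{u₀, u} R) (Type u) := ⟨DGAlgebra.carrier⟩

attribute [instance] DGAlgebra.ring DGAlgebra.algebra DGAlgebra.graded

variable (A : DGAlgebra.{u₀, u} R)

/-- `x y = (-1) ^ (|x| |y|) y x` for all homogeneous `x`, `y`. -/
def IsGradedCommutative : Prop :=
  ∀ ⦃i j : ℤ⦄ ⦃x y : A⦄, x ∈ A.grading i → y ∈ A.grading j →
    x * y = (i * j).negOnePow • (y * x)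

/-- The homology of `(A, d)` vanishes. -/
def IsAcyclic : Prop := ∀ x : A, A.d x = 0 → ∃ y : A, A.d y = x

/-- An additive subgroup that is homogeneous and stable under the differential. -/
def IsDGStable (I : AddSubgroup A) : Prop :=
  (∀ x ∈ I, ∀ i : ℤ, (DirectSum.decompose A.grading x i : A) ∈ I) ∧ ∀ x ∈ I, A.d x ∈ I

/-- Homogeneous left ideals that are stable under the differential. -/
def IsDGLeftIdeal (I : Submodule A A) : Prop := A.IsDGStable I.toAddSubgroup

/-- Homogeneous right ideals that are stable under the differential. -/
def IsDGRightIdeal (I : Submodule Aᵐᵒᵖ A) : Prop := A.IsDGStable I.toAddSubgroup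

/-- A dg-division algebra (the zero algebra is not excluded): the only dg-left ideals are `0` and `A`, and the only dg-right ideals
are `0` and `A`. -/
def IsDGDivision : Prop :=
  (∀ I : Submodule A A, A.IsDGLeftIdeal I → I = ⊥ ∨ I = ⊤) ∧
    ∀ I : Submodule Aᵐᵒᵖ A, A.IsDGRightIdeal I → I = ⊥ ∨ I = ⊤

/-- The descending chain condition on dg-left ideals. -/
def IsDGArtinian : Prop := WellFoundedLT {I : Submodule A A // A.IsDGLeftIdeal I}

/-- The ascending chain condition on dg-left ideals. -/
def IsDGNoetherian : Prop := WellFoundedGT {I : Submodule A A // A.IsDGLeftIdeal I}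

/-! ### The sign involution and the cycles -/

/-- The linear map that sends a homogeneous element `a` to `(-1) ^ |a| a`. -/
noncomputable def sign : A →ₗ[R] A :=
  (DirectSum.toModule R ℤ A fun i => (i.negOnePow : ℤ) • (A.grading i).subtype) ∘ₗ
    (DirectSum.decomposeLinearEquiv A.grading).toLinearMap

theorem sign_of_mem {i : ℤ} {a : A} (ha : a ∈ A.grading i) : A.sign a = i.negOnePow • a := by
  simp only [sign, LinearMap.comp_apply, LinearEquiv.coe_coe,
    DirectSum.decomposeLinearEquiv_apply, DirectSum.decompose_of_mem _ ha]
  erw [DirectSum.toModule_lof]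
  simp [Units.smul_def]

theorem induction_homogeneous {p : A → Prop} (h0 : p 0)
    (hom : ∀ (i : ℤ) (a : A), a ∈ A.grading i → p a) (add : ∀ a b, p a → p b → p (a + b))
    (a : A) : p a :=
  DirectSum.Decomposition.inductionOn A.grading h0 (fun {i} m => hom i m m.2) add a

theorem sign_mul (a b : A) : A.sign (a * b) = A.sign a * A.sign b := by
  induction a using A.induction_homogeneous with
  | h0 => simp
  | add x y hx hy => simp [add_mul, hx, hy]
  | hom i x hx =>
    induction b using A.induction_homogeneous with
    | h0 => simp
    | add y z hy hz => simp [mul_add, hy, hz]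
    | hom j y hy =>
      rw [A.sign_of_mem hx, A.sign_of_mem hy, A.sign_of_mem (SetLike.mul_mem_graded hx hy),
        Int.negOnePow_add, smul_mul_smul_comm]

theorem d_mul (a b : A) : A.d (a * b) = A.d a * b + A.sign a * A.d b := by
  induction a using A.induction_homogeneous with
  | h0 => simp
  | add x y hx hy => simp only [add_mul, map_add, hx, hy]; abel
  | hom i x hx => rw [A.leibniz hx, A.sign_of_mem hx, smul_mul_assoc]

theorem d_one : A.d 1 = 0 := by
  have h := A.leibniz (i := 0) SetLike.GradedOne.one_mem (1 : A)
  simpa using h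

/-- The subalgebra `ker d`. -/
def cycles : Subalgebra R A where
  carrier := {a | A.d a = 0}
  mul_mem' {a b} ha hb := by
    simp only [Set.mem_ofPred_eq] at ha hb ⊢
    rw [d_mul, ha, hb]; simp
  add_mem' {a b} ha hb := by
    simp only [Set.mem_ofPred_eq] at ha hb ⊢
    rw [map_add, ha, hb, add_zero]
  algebraMap_mem' r := by
    simp only [Set.mem_ofPred_eq]
    rw [Algebra.algebraMap_eq_smul_one, map_smul, d_one, smul_zero]

/-- The homogeneous components of `ker d`. -/
def cyclesGrading (i : ℤ) : Submodule R A.cycles :=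
  (A.grading i).comap A.cycles.val.toLinearMap

theorem decompose_d (a : A) (i : ℤ) :
    (DirectSum.decompose A.grading (A.d a) (i + 1) : A) =
      A.d (DirectSum.decompose A.grading a i) := by
  induction a using A.induction_homogeneous with
  | h0 => simp
  | add x y hx hy => simp [DirectSum.decompose_add, hx, hy]
  | hom j x hx =>
    by_cases h : j = i
    · subst h
      rw [DirectSum.decompose_of_mem_same _ hx, DirectSum.decompose_of_mem_same _ (A.d_mem hx)]
    · rw [DirectSum.decompose_of_mem_ne _ hx h,
        DirectSum.decompose_of_mem_ne _ (A.d_mem hx) (by simpa using h), map_zero]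

theorem decompose_mem_cycles {a : A} (ha : a ∈ A.cycles) (i : ℤ) :
    (DirectSum.decompose A.grading a i : A) ∈ A.cycles := by
  have h : A.d a = 0 := ha
  change A.d _ = 0
  rw [← decompose_d, h]; simp

theorem cyclesGrading_isInternal : DirectSum.IsInternal A.cyclesGrading := by
  classical
  have key : ∀ (x : DirectSum ℤ fun i => A.cyclesGrading i) (i : ℤ),
      (DirectSum.decompose A.grading
        ((DirectSum.coeAddMonoidHom A.cyclesGrading x : A.cycles) : A) i : A) =
        ((x i : A.cycles) : A) := by
    intro x i
    induction x using DirectSum.induction_on with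
    | zero => simp
    | add x y hx hy =>
      rw [map_add, Subalgebra.coe_add, DirectSum.decompose_add, DirectSum.add_apply,
        Submodule.coe_add, hx, hy]; rfl
    | of j y =>
      rw [DirectSum.coeAddMonoidHom_of]
      have hy : ((y : A.cycles) : A) ∈ A.grading j := y.2
      by_cases h : j = i
      · subst h
        rw [DirectSum.decompose_of_mem_same _ hy, DirectSum.of_eq_same]
      · rw [DirectSum.decompose_of_mem_ne _ hy h, DirectSum.of_eq_of_ne _ _ _ (Ne.symm h)]; rfl
  constructor
  · rw [injective_iff_map_eq_zero]
    intro x hx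
    refine DFinsupp.ext fun i => ?_
    have h := key x i
    rw [hx] at h
    apply Subtype.ext
    apply Subtype.ext
    simpa using h.symm
  · intro z
    refine ⟨∑ i ∈ (DirectSum.decompose A.grading (z : A)).support,
      DirectSum.of (fun i => A.cyclesGrading i) i
        ⟨⟨_, A.decompose_mem_cycles z.2 i⟩, (DirectSum.decompose A.grading (z : A) i).2⟩, ?_⟩
    rw [map_sum]
    apply Subtype.ext
    simp only [DirectSum.coeAddMonoidHom_of, AddSubmonoidClass.coe_finsetSum]
    exact DirectSum.sum_support_decompose A.grading (z : A)

instance : SetLike.GradedMonoid A.cyclesGrading where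
  one_mem := SetLike.GradedOne.one_mem (A := A.grading)
  mul_mem _ _ _ _ hx hy := SetLike.GradedMul.mul_mem (A := A.grading) hx hy

/-- `ker d` is a graded algebra. -/
noncomputable instance : GradedAlgebra A.cyclesGrading where
  toDecomposition := A.cyclesGrading_isInternal.chooseDecomposition

/-! ### Extensions and the tensor product `B ⊗_A B` -/

variable {A}
variable {B : DGAlgebra.{u₀, u'} R}

/-- A dg-extension of dg-algebras: a homomorphism of dg-algebras. -/
structure Extension (A : DGAlgebra.{u₀, u} R) (B : DGAlgebra.{u₀, u'} R) where
  toAlgHom : A →ₐ[R] B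
  map_mem : ∀ {i : ℤ} {a : A}, a ∈ A.grading i → toAlgHom a ∈ B.grading i
  map_d : ∀ a : A, toAlgHom (A.d a) = B.d (toAlgHom a)

namespace Extension

variable (φ : Extension A B)

theorem map_sign (a : A) : φ.toAlgHom (A.sign a) = B.sign (φ.toAlgHom a) := by
  induction a using A.induction_homogeneous with
  | h0 => simp
  | add x y hx hy => simp [hx, hy]
  | hom i x hx =>
    rw [A.sign_of_mem hx, B.sign_of_mem (φ.map_mem hx), Units.smul_def, Units.smul_def, map_zsmul]

/-- The relations `b₁ φ(a) ⊗ b₂ = b₁ ⊗ φ(a) b₂` in `B ⊗_R B`. -/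
def relations : Submodule R (B ⊗[R] B) :=
  Submodule.span R {t | ∃ (b₁ b₂ : B) (a : A),
    t = (b₁ * φ.toAlgHom a) ⊗ₜ[R] b₂ - b₁ ⊗ₜ[R] (φ.toAlgHom a * b₂)}

/-- The tensor product `B ⊗_A B` over the (in general noncommutative) algebra `A`, where `B` is an
`A`-bimodule through `φ`. -/
abbrev Tensor : Type u' := (B ⊗[R] B) ⧸ φ.relations

/-- The pure tensor `b₁ ⊗ b₂` in `B ⊗_A B`. -/
def tmul (b₁ b₂ : B) : φ.Tensor := φ.relations.mkQ (b₁ ⊗ₜ[R] b₂)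

theorem relations_le {f : B ⊗[R] B →ₗ[R] B ⊗[R] B}
    (h : ∀ (b₁ b₂ : B) (a : A),
      f ((b₁ * φ.toAlgHom a) ⊗ₜ[R] b₂ - b₁ ⊗ₜ[R] (φ.toAlgHom a * b₂)) ∈ φ.relations) :
    φ.relations ≤ φ.relations.comap f := by
  refine Submodule.span_le.2 ?_
  rintro _ ⟨b₁, b₂, a, rfl⟩
  exact h b₁ b₂ a

theorem rel_mem (b₁ b₂ : B) (a : A) :
    (b₁ * φ.toAlgHom a) ⊗ₜ[R] b₂ - b₁ ⊗ₜ[R] (φ.toAlgHom a * b₂) ∈ φ.relations :=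
  Submodule.subset_span ⟨b₁, b₂, a, rfl⟩

/-- The left action `b (b₁ ⊗ b₂) = b b₁ ⊗ b₂` of `B` on `B ⊗_A B`. -/
def lmul (b : B) : φ.Tensor →ₗ[R] φ.Tensor :=
  φ.relations.mapQ φ.relations (TensorProduct.map (LinearMap.mulLeft R b) LinearMap.id)
    (φ.relations_le fun b₁ b₂ a => by
      simpa [mul_assoc] using φ.rel_mem (b * b₁) b₂ a)

/-- The right action `(b₁ ⊗ b₂) b = b₁ ⊗ b₂ b` of `B` on `B ⊗_A B`. -/
def rmul (b : B) : φ.Tensor →ₗ[R] φ.Tensor :=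
  φ.relations.mapQ φ.relations (TensorProduct.map LinearMap.id (LinearMap.mulRight R b))
    (φ.relations_le fun b₁ b₂ a => by
      simpa [mul_assoc] using φ.rel_mem b₁ (b₂ * b) a)

/-- The differential of `B ⊗_A B`, given by
`b₁ ⊗ b₂ ↦ d b₁ ⊗ b₂ + (-1) ^ |b₁| b₁ ⊗ d b₂` for homogeneous `b₁`. -/
noncomputable def tensorD : φ.Tensor →ₗ[R] φ.Tensor :=
  φ.relations.mapQ φ.relations
    (TensorProduct.map B.d LinearMap.id + TensorProduct.map B.sign B.d)
    (φ.relations_le fun b₁ b₂ a => by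
      have h := φ.relations.add_mem (φ.relations.add_mem (φ.rel_mem (B.d b₁) b₂ a)
        (φ.rel_mem (B.sign b₁) b₂ (A.d a))) (φ.rel_mem (B.sign b₁) (B.d b₂) (A.sign a))
      convert h using 1
      simp only [map_sub, LinearMap.add_apply, TensorProduct.map_tmul, LinearMap.id_apply,
        B.d_mul, B.sign_mul, φ.map_d, φ.map_sign, TensorProduct.add_tmul, TensorProduct.tmul_add]
      abel)

/-- The component of degree `n` of `B ⊗_A B`, spanned by all `b₁ ⊗ b₂` with `b₁`, `b₂` homogeneous
and `|b₁| + |b₂| = n`. -/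
def tensorGrading (n : ℤ) : Submodule R φ.Tensor :=
  Submodule.span R {t | ∃ (i j : ℤ) (b₁ b₂ : B), b₁ ∈ B.grading i ∧ b₂ ∈ B.grading j ∧
    i + j = n ∧ t = φ.tmul b₁ b₂}

/-- The multiplication map `B ⊗_A B → B`. -/
def mulMap : φ.Tensor →ₗ[R] B :=
  φ.relations.liftQ (LinearMap.mul' R B) (by
    refine Submodule.span_le.2 ?_
    rintro _ ⟨b₁, b₂, a, rfl⟩
    simp [mul_assoc])

/-- The extension is dg-separable: the multiplication map `B ⊗_A B → B` is split by a morphism of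
dg-`B`-`B`-bimodules (of degree `0`, bilinear, and commuting with the differentials). -/
def IsDGSeparable : Prop :=
  ∃ ρ : B →ₗ[R] φ.Tensor,
    (∀ b x : B, ρ (b * x) = φ.lmul b (ρ x)) ∧
    (∀ b x : B, ρ (x * b) = φ.rmul b (ρ x)) ∧
    (∀ (n : ℤ) (x : B), x ∈ B.grading n → ρ x ∈ φ.tensorGrading n) ∧
    (∀ x : B, ρ (B.d x) = φ.tensorD (ρ x)) ∧
    ∀ x : B, φ.mulMap (ρ x) = x

end Extension

end DGAlgebra

/-! ### Dg-modules -/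

/-- A left dg-module over `(A, d)`: a `ℤ`-graded left `A`-module with an endomorphism `δ` of degree
`1` such that `δ² = 0` and `δ (a m) = d a m + (-1) ^ |a| a δ m`. (The base ring acts through `A`,
and `δ` is automatically linear over it.) -/
structure DGModule {R : Type u₀} [CommRing R] (A : DGAlgebra.{u₀, u} R) where
  carrier : Type v
  [addCommGroup : AddCommGroup carrier]
  [module : Module A carrier]
  /-- the homogeneous components -/
  grading : ℤ → AddSubgroup carrier
  [decomposition : DirectSum.Decomposition grading]
  smul_mem : ∀ {i j : ℤ} {a : A} {m : carrier}, a ∈ A.grading i → m ∈ grading j →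
    a • m ∈ grading (i + j)
  /-- the differential -/
  δ : carrier →+ carrier
  δ_mem : ∀ {i : ℤ} {m : carrier}, m ∈ grading i → δ m ∈ grading (i + 1)
  δ_δ : ∀ m : carrier, δ (δ m) = 0
  leibniz : ∀ {i : ℤ} {a : A}, a ∈ A.grading i → ∀ m : carrier,
    δ (a • m) = A.d a • m + i.negOnePow • (a • δ m)

namespace DGModule

variable {R : Type u₀} [CommRing R] {A : DGAlgebra.{u₀, u} R}

instance : CoeSort (DGModule.{u₀, u, v} A) (Type v) := ⟨DGModule.carrier⟩

attribute [instance] DGModule.addCommGroup DGModule.module DGModule.decomposition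

/-- Morphisms of dg-modules: `A`-linear maps of degree `0` that commute with the differentials. -/
@[ext]
structure Hom (M N : DGModule.{u₀, u, v} A) where
  toLinearMap : M →ₗ[A] N
  map_mem : ∀ (i : ℤ) (m : M), m ∈ M.grading i → toLinearMap m ∈ N.grading i
  map_δ : ∀ m : M, toLinearMap (M.δ m) = N.δ (toLinearMap m)

/-- The category of left dg-modules over `(A, d)`. -/
instance : Category (DGModule.{u₀, u, v} A) where
  Hom M N := Hom M N
  id M := ⟨LinearMap.id, fun _ _ h => h, fun _ => rfl⟩
  comp f g := ⟨g.toLinearMap ∘ₗ f.toLinearMap, fun i m h => g.map_mem i _ (f.map_mem i m h),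
    fun m => by simp [f.map_δ, g.map_δ]⟩

section Preadditive

variable {M N : DGModule.{u₀, u, v} A}

instance : Zero (Hom M N) := ⟨⟨0, fun i _ _ => (N.grading i).zero_mem, fun m => by simp⟩⟩

instance : Add (Hom M N) := ⟨fun f g => ⟨f.toLinearMap + g.toLinearMap,
  fun i m h => (N.grading i).add_mem (f.map_mem i m h) (g.map_mem i m h),
  fun m => by simp [f.map_δ, g.map_δ]⟩⟩

instance : Neg (Hom M N) := ⟨fun f => ⟨-f.toLinearMap,
  fun i m h => (N.grading i).neg_mem (f.map_mem i m h), fun m => by simp [f.map_δ]⟩⟩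

instance : AddCommGroup (Hom M N) where
  add_assoc f g h := Hom.ext (add_assoc f.toLinearMap g.toLinearMap h.toLinearMap)
  zero_add f := Hom.ext (zero_add f.toLinearMap)
  add_zero f := Hom.ext (add_zero f.toLinearMap)
  add_comm f g := Hom.ext (add_comm f.toLinearMap g.toLinearMap)
  neg_add_cancel f := Hom.ext (neg_add_cancel f.toLinearMap)
  nsmul := nsmulRec
  zsmul := zsmulRec

/-- Morphisms of dg-modules are added pointwise. -/
instance : Preadditive (DGModule.{u₀, u, v} A) where
  homGroup M N := inferInstanceAs (AddCommGroup (Hom M N))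
  add_comp _ _ _ f f' g := Hom.ext (LinearMap.comp_add f.toLinearMap f'.toLinearMap g.toLinearMap)
  comp_add _ _ _ f g g' := Hom.ext (LinearMap.add_comp f.toLinearMap g'.toLinearMap g.toLinearMap)

end Preadditive

variable (M : DGModule.{u₀, u, v} A)

/-- Dg-submodules: homogeneous submodules that are stable under the differential. -/
def IsDGSubmodule (N : Submodule A M) : Prop :=
  (∀ m ∈ N, ∀ i : ℤ, (DirectSum.decompose M.grading m i : M) ∈ N) ∧ ∀ m ∈ N, M.δ m ∈ N

/-- Simple dg-submodules: nonzero dg-submodules without proper nonzero dg-submodules. -/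
def IsSimpleDGSubmodule (S : Submodule A M) : Prop :=
  M.IsDGSubmodule S ∧ S ≠ ⊥ ∧ ∀ N : Submodule A M, M.IsDGSubmodule N → N ≤ S → N = ⊥ ∨ N = S

/-- The dg-module is the (internal) direct sum of a family of simple dg-submodules. -/
def IsDirectSumOfSimples : Prop :=
  ∃ s : Set (Submodule A M), (∀ S ∈ s, M.IsSimpleDGSubmodule S) ∧ sSupIndep s ∧ sSup s = ⊤

end DGModule

/-- An (abelian) category is semisimple if every short exact sequence in it splits. -/
def IsSemisimpleCategory (C : Type u) [Category.{v} C] [Preadditive C] : Prop :=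
  ∀ S : ShortComplex C, S.ShortExact → Nonempty S.Splitting

/-! ### Graded modules over a graded ring -/

section Graded

variable {R : Type u₀} [CommRing R] {S : Type u} [Ring S] [Algebra R S]

/-- A `ℤ`-graded left module over the `ℤ`-graded algebra `S`. -/
structure GrModule (𝒮 : ℤ → Submodule R S) where
  carrier : Type w
  [addCommGroup : AddCommGroup carrier]
  [module : Module S carrier]
  /-- the homogeneous components -/
  grading : ℤ → AddSubgroup carrier
  [decomposition : DirectSum.Decomposition grading]
  smul_mem : ∀ {i j : ℤ} {a : S} {m : carrier}, a ∈ 𝒮 i → m ∈ grading j →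
    a • m ∈ grading (i + j)

namespace GrModule

variable {𝒮 : ℤ → Submodule R S}

instance : CoeSort (GrModule.{u₀, u, w} 𝒮) (Type w) := ⟨GrModule.carrier⟩

attribute [instance] GrModule.addCommGroup GrModule.module GrModule.decomposition

variable (M : GrModule.{u₀, u, w} 𝒮)

/-- Graded submodules. -/
def IsGrSubmodule (N : Submodule S M) : Prop :=
  ∀ m ∈ N, ∀ i : ℤ, (DirectSum.decompose M.grading m i : M) ∈ N

/-- Gr-simple submodules: nonzero graded submodules without proper nonzero graded submodules. -/
def IsGrSimpleSubmodule (T : Submodule S M) : Prop :=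
  M.IsGrSubmodule T ∧ T ≠ ⊥ ∧ ∀ N : Submodule S M, M.IsGrSubmodule N → N ≤ T → N = ⊥ ∨ N = T

/-- The graded module is the (internal) direct sum of a family of gr-simple submodules. -/
def IsDirectSumOfSimples : Prop :=
  ∃ s : Set (Submodule S M), (∀ T ∈ s, M.IsGrSimpleSubmodule T) ∧ sSupIndep s ∧ sSup s = ⊤

end GrModule

/-- A graded algebra is graded-semisimple if every graded left module over it is a direct sum of
gr-simple modules. -/
def IsGradedSemisimple (𝒮 : ℤ → Submodule R S) [GradedAlgebra 𝒮] : Prop :=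
  ∀ M : GrModule.{u₀, u, w} 𝒮, M.IsDirectSumOfSimples

end Graded

/-! Both halves rest on acyclicity giving `y` of degree `-1` with `d y = 1`, hence `m = δ (y m) + y
(δ m)` in every dg-module: homogeneous cycles generate.

Over `K` this gives semisimplicity. For a homogeneous cycle `z` of `M`, the `k` with `k z` in a
given dg-submodule form a dg-left ideal of `K`, so `K z` is zero or simple (`isAtom_range_smulHom`).
These `K z` span `M`, and a compactly generated modular lattice whose atoms join to the top is
complemented (`complementedLattice`). Every dg-submodule over `A` is therefore the image of a
`K`-linear dg-projection `h`.

Separability makes it `A`-linear, as in Maschke's theorem: with `ρ 1 = ∑ bᵢ ⊗ cᵢ`, the map `m ↦ ∑ bᵢ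
h (cᵢ m)` is a projection of dg-modules over `A` onto the same submodule (`exists_dg_projection`).
Once all dg-submodules are retracts, epimorphisms split, so all objects are projective, all short
exact sequences split, and all dg-modules are direct sums of simple ones.

For the cycles, write `A` as a sum of simple dg-left ideals `I`. If `v` is a homogeneous element of
a graded `ker d`-module, then `(I ∩ ker d) v` is zero or gr-simple (`isAtom_cyclesSMul`), because a
graded left ideal `J` of `ker d` is recovered as the cycles of the dg-left ideal `extendIdeal J`.
Writing `y` as a sum of elements of the ideals `I` and applying `d` puts `v = d y • v` in the sum of
these modules. -/

/-! ### Submodules stable under a set of additive endomorphisms -/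

section Stable

/-- The complete lattice of submodules that are stable under a set of additive endomorphisms. -/
def stableSubmodules (S : Type*) {M : Type*} [Ring S] [AddCommGroup M] [Module S M]
    (Ω : Set (M →+ M)) : CompleteSublattice (Submodule S M) :=
  .mk' {N | ∀ f ∈ Ω, ∀ m ∈ N, f m ∈ N}
    (fun s hs f hf m hm => by
      rw [sSup_eq_iSup'] at hm ⊢
      refine Submodule.iSup_induction _ (motive := fun m => f m ∈ _) hm
        (fun N x hx => Submodule.mem_iSup_of_mem N (hs N.2 f hf x hx)) (by simp)
        fun x y hx hy => ?_
      rw [map_add]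
      exact add_mem hx hy)
    (fun s hs f hf m hm => by
      rw [Submodule.mem_sInf] at hm ⊢
      exact fun N hN => hs hN f hf m (hm N hN))

variable {S M : Type*} [Ring S] [AddCommGroup M] [Module S M] {Ω : Set (M →+ M)}

theorem mem_stableSubmodules {N : Submodule S M} :
    N ∈ stableSubmodules S Ω ↔ ∀ f ∈ Ω, ∀ m ∈ N, f m ∈ N := Iff.rfl

namespace stableSubmodules

instance : IsModularLattice (stableSubmodules S Ω) where
  sup_inf_le_assoc_of_le {x} y {z} h := by
    change ((x : Submodule S M) ⊔ y) ⊓ z ≤ (x : Submodule S M) ⊔ (y : Submodule S M) ⊓ z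
    exact sup_inf_le_assoc_of_le _ h

/-- The smallest stable submodule containing an element. -/
def generated (S : Type*) {M : Type*} [Ring S] [AddCommGroup M] [Module S M] (Ω : Set (M →+ M))
    (x : M) : stableSubmodules S Ω :=
  sInf {N | x ∈ (N : Submodule S M)}

theorem generated_le {x : M} {N : stableSubmodules S Ω} :
    generated S Ω x ≤ N ↔ x ∈ (N : Submodule S M) := by
  refine ⟨fun h => h ?_, fun h => sInf_le h⟩
  simp +contextual [generated, Submodule.mem_sInf]

/-- A directed supremum of submodules is their union, so a single element already lies in one
member. -/
theorem isCompactElement_generated (x : M) : IsCompactElement (generated S Ω x) := by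
  rw [CompleteLattice.isCompactElement_iff_le_of_directed_sSup_le]
  intro s hs hd h
  rw [generated_le, CompleteSublattice.coe_sSup, Submodule.mem_sSup_of_directed] at h
  · obtain ⟨_, ⟨N, hN, rfl⟩, hx⟩ := h
    exact ⟨N, hN, generated_le.2 hx⟩
  · obtain ⟨N, hN⟩ := hs
    exact ⟨N, N, hN, rfl⟩
  · rintro _ ⟨N, hN, rfl⟩ _ ⟨P, hP, rfl⟩
    obtain ⟨Q, hQ, h₁, h₂⟩ := hd N hN P hP
    exact ⟨Q, ⟨Q, hQ, rfl⟩, h₁, h₂⟩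

/-- With modularity, this makes complementedness, atomisticity and "the atoms join to the top"
interchangeable. -/
instance : IsCompactlyGenerated (stableSubmodules S Ω) where
  exists_sSup_eq N := by
    refine ⟨generated S Ω '' (N : Submodule S M), ?_, le_antisymm (sSup_le ?_) ?_⟩
    · rintro _ ⟨x, -, rfl⟩
      exact isCompactElement_generated x
    · rintro _ ⟨x, hx, rfl⟩
      exact generated_le.2 hx
    · intro x hx
      exact generated_le.1 (le_sSup (Set.mem_image_of_mem _ hx))

/-- A stable submodule with a stable complement is the image of an equivariant projection. -/
theorem exists_projection [ComplementedLattice (stableSubmodules S Ω)] {N : Submodule S M}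
    (hN : N ∈ stableSubmodules S Ω) :
    ∃ h : M →ₗ[S] M, (∀ m, h m ∈ N) ∧ (∀ n ∈ N, h n = n) ∧ ∀ f ∈ Ω, ∀ m, h (f m) = f (h m) := by
  obtain ⟨C, hC⟩ := exists_isCompl (⟨N, hN⟩ : stableSubmodules S Ω)
  have hNC : IsCompl N (C : Submodule S M) := by
    rw [isCompl_iff, disjoint_iff, codisjoint_iff] at hC ⊢
    exact ⟨congrArg Subtype.val hC.1, congrArg Subtype.val hC.2⟩
  refine ⟨N.projection C hNC, Submodule.projection_apply_mem hNC,
    fun n hn => Submodule.projection_apply_of_mem_left hNC hn, fun f hf m => ?_⟩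
  -- Split `m` along `N` and its complement; `f` preserves both summands, so the projection keeps
  -- only `f` of the first.
  conv_lhs => rw [← Submodule.projection_add_projection_eq_self hNC m, map_add, map_add]
  rw [Submodule.projection_apply_of_mem_left hNC
      (hN f hf _ (Submodule.projection_apply_mem hNC m)),
    (Submodule.projection_apply_eq_zero_iff hNC).2
      (C.2 f hf _ (Submodule.projection_apply_mem hNC.symm m)), add_zero]

theorem isAtom_iff {N : stableSubmodules S Ω} :
    IsAtom N ↔ (N : Submodule S M) ≠ ⊥ ∧ ∀ P : Submodule S M, P ∈ stableSubmodules S Ω →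
      P ≤ N → P = ⊥ ∨ P = N := by
  refine ⟨fun h => ⟨fun h0 => h.1 (Subtype.ext h0), fun P hP hPN => ?_⟩, fun h =>
    ⟨fun h0 => h.1 (congrArg Subtype.val h0), fun P hP => ?_⟩⟩
  · rcases h.le_iff.1 (show (⟨P, hP⟩ : stableSubmodules S Ω) ≤ N from hPN) with h' | h'
    · exact .inl (congrArg Subtype.val h')
    · exact .inr (congrArg Subtype.val h')
  · rcases h.2 P P.2 hP.le with h' | h'
    · exact Subtype.ext h'
    · exact absurd (Subtype.ext h') hP.ne

theorem exists_direct_sum (h : sSup {N : stableSubmodules S Ω | IsAtom N} = ⊤) :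
    ∃ s : Set (Submodule S M), (∀ N ∈ s, N ∈ stableSubmodules S Ω ∧ N ≠ ⊥ ∧
      ∀ P : Submodule S M, P ∈ stableSubmodules S Ω → P ≤ N → P = ⊥ ∨ P = N) ∧
      sSupIndep s ∧ sSup s = ⊤ := by
  obtain ⟨s, hs, htop, hatom⟩ := exists_sSupIndep_of_sSup_atoms_eq_top h
  refine ⟨Subtype.val '' s, ?_, ?_, congrArg Subtype.val htop⟩
  · rintro _ ⟨N, hN, rfl⟩
    exact ⟨N.2, isAtom_iff.1 (hatom hN)⟩
  · rintro _ ⟨N, hN, rfl⟩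
    have h := disjoint_iff.1 (hs hN)
    rw [← Set.image_singleton, ← Set.image_sdiff Subtype.val_injective, disjoint_iff]
    exact congrArg Subtype.val h

theorem sSup_atoms_eq_top_of_forall_mem
    (h : ∀ m : M, m ∈ ((sSup {N : stableSubmodules S Ω | IsAtom N} :
      stableSubmodules S Ω) : Submodule S M)) :
    sSup {N : stableSubmodules S Ω | IsAtom N} = ⊤ :=
  top_le_iff.1 fun m _ => h m

/-- Serves submodules generated by one element, which are simple unless they vanish. -/
theorem le_sSup_atoms {N : stableSubmodules S Ω} (h : N ≠ ⊥ → IsAtom N) :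
    N ≤ sSup {N : stableSubmodules S Ω | IsAtom N} := by
  by_cases h0 : N = ⊥
  · rw [h0]; exact bot_le
  · exact le_sSup (h h0)

end stableSubmodules

end Stable

/-! ### Projections to the homogeneous components -/

section GradedProj

variable {M : Type*} [AddCommGroup M] (ℳ : ℤ → AddSubgroup M) [DirectSum.Decomposition ℳ]

/-- The projection to a homogeneous component, as an additive endomorphism. -/
def gradedProj (i : ℤ) : M →+ M where
  toFun m := DirectSum.decompose ℳ m i
  map_zero' := by simp
  map_add' := by simp [DirectSum.decompose_add]

theorem gradedProj_apply (i : ℤ) (m : M) : gradedProj ℳ i m = DirectSum.decompose ℳ m i := rfl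

theorem gradedProj_mem (i : ℤ) (m : M) : gradedProj ℳ i m ∈ ℳ i :=
  (DirectSum.decompose ℳ m i).2

theorem gradedProj_of_mem {i : ℤ} {m : M} (hm : m ∈ ℳ i) : gradedProj ℳ i m = m :=
  DirectSum.decompose_of_mem_same ℳ hm

theorem mem_of_gradedProj_comm {h : M →+ M} {i : ℤ}
    (hh : ∀ m, h (gradedProj ℳ i m) = gradedProj ℳ i (h m)) {m : M} (hm : m ∈ ℳ i) :
    h m ∈ ℳ i := by
  rw [← gradedProj_of_mem ℳ hm, hh]
  exact gradedProj_mem ℳ i _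

theorem homogeneous_induction {p : M → Prop} (h0 : p 0) (hom : ∀ (i : ℤ) (m : M), m ∈ ℳ i → p m)
    (add : ∀ x y, p x → p y → p (x + y)) (m : M) : p m :=
  DirectSum.Decomposition.inductionOn ℳ h0 (fun {i} m => hom i m m.2) add m

theorem gradedProj_comm_of_mem {N : Type*} [AddCommGroup N] (𝒩 : ℤ → AddSubgroup N)
    [DirectSum.Decomposition 𝒩] {f : M →+ N} {n : ℤ}
    (hf : ∀ i m, m ∈ ℳ i → f m ∈ 𝒩 (i + n)) (i : ℤ) (m : M) :
    gradedProj 𝒩 (i + n) (f m) = f (gradedProj ℳ i m) := by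
  induction m using homogeneous_induction ℳ with
  | h0 => simp
  | add x y hx hy => simp only [map_add, hx, hy]
  | hom j m hm =>
    by_cases h : j = i
    · subst h
      rw [gradedProj_of_mem ℳ hm, gradedProj_of_mem 𝒩 (hf j m hm)]
    · rw [gradedProj_apply, gradedProj_apply, DirectSum.decompose_of_mem_ne _ hm h,
        DirectSum.decompose_of_mem_ne _ (hf j m hm) (by simpa using h), map_zero]

/-- Multiples of a homogeneous element decompose as the coefficients do. -/
theorem gradedProj_smul {R S : Type*} [CommRing R] [Ring S] [Algebra R S] [Module S M]
    (𝒮 : ℤ → Submodule R S) [GradedAlgebra 𝒮]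
    (hsmul : ∀ {i j : ℤ} {a : S} {m : M}, a ∈ 𝒮 i → m ∈ ℳ j → a • m ∈ ℳ (i + j))
    {n : ℤ} {m : M} (hm : m ∈ ℳ n) (i : ℤ) (a : S) :
    gradedProj ℳ (i + n) (a • m) = (DirectSum.decompose 𝒮 a i : S) • m := by
  induction a using DirectSum.Decomposition.inductionOn 𝒮 with
  | zero => simp
  | add x y hx hy => simp [add_smul, hx, hy]
  | @homogeneous j a =>
    by_cases h : j = i
    · subst h
      rw [gradedProj_of_mem ℳ (hsmul a.2 hm), DirectSum.decompose_of_mem_same _ a.2]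
    · rw [gradedProj_apply, DirectSum.decompose_of_mem_ne _ (hsmul a.2 hm) (by simpa using h),
        DirectSum.decompose_of_mem_ne _ a.2 h, zero_smul]

end GradedProj

/-! ### Dg-submodules -/

namespace DGModule

variable {R : Type u₀} [CommRing R] {A : DGAlgebra.{u₀, u} R} (M : DGModule.{u₀, u, v} A)

/-- The differential and the projections to the homogeneous components. -/
def operators : Set (M →+ M) := insert M.δ (Set.range (gradedProj M.grading))

theorem mem_stableSubmodules_operators {N : Submodule A M} :
    N ∈ stableSubmodules A M.operators ↔ M.IsDGSubmodule N := by
  rw [mem_stableSubmodules]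
  refine ⟨fun h => ⟨fun m hm i => h _ (.inr ⟨i, rfl⟩) m hm, h _ (.inl rfl)⟩, ?_⟩
  rintro h _ (rfl | ⟨i, rfl⟩) m hm
  · exact h.2 m hm
  · exact h.1 m hm i

theorem isDirectSumOfSimples_of_complementedLattice
    [ComplementedLattice (stableSubmodules A M.operators)] : M.IsDirectSumOfSimples := by
  have := complementedLattice_iff_isAtomistic.1
    (inferInstance : ComplementedLattice (stableSubmodules A M.operators))
  obtain ⟨s, hs, hind, htop⟩ := stableSubmodules.exists_direct_sum
    (sSup_atoms_eq_top (α := stableSubmodules A M.operators))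
  exact ⟨s, fun N hN => ⟨M.mem_stableSubmodules_operators.1 (hs N hN).1, (hs N hN).2.1,
    fun P hP => (hs N hN).2.2 P (M.mem_stableSubmodules_operators.2 hP)⟩, hind, htop⟩

end DGModule

namespace DGAlgebra

variable {R : Type u₀} [CommRing R]

/-- In an acyclic dg-algebra, `1` is the differential of an element of degree `-1`. -/
theorem IsAcyclic.exists_d_eq_one {A : DGAlgebra.{u₀, u} R} (hA : A.IsAcyclic) :
    ∃ y ∈ A.grading (-1), A.d y = 1 := by
  obtain ⟨y, hy⟩ := hA 1 A.d_one
  refine ⟨DirectSum.decompose A.grading y (-1), SetLike.coe_mem _, ?_⟩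
  rw [← A.decompose_d, hy]
  exact DirectSum.decompose_of_mem_same _ (i := 0) SetLike.GradedOne.one_mem

/-- A contracting homotopy of a dg-module over an acyclic dg-algebra. -/
theorem homotopy {A : DGAlgebra.{u₀, u} R} {y : A} (hy : y ∈ A.grading (-1)) (hd : A.d y = 1)
    (M : DGModule.{u₀, u, v} A) (m : M) : m = M.δ (y • m) + y • M.δ m := by
  rw [M.leibniz hy, hd]
  simp

/-! ### Semisimplicity of dg-modules over an acyclic dg-division algebra. -/

namespace Extension

variable {K : DGAlgebra.{u₀, u'} R} {A : DGAlgebra.{u₀, u} R} (φ : Extension K A)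
  (M : DGModule.{u₀, u, v} A)

/-- The operators whose stable subgroups are the dg-submodules over the smaller algebra. -/
def operators : Set (M →+ M) :=
  M.operators ∪ Set.range fun k : K => DistribSMul.toAddMonoidHom M (φ.toAlgHom k)

/-- The multiples of an element by scalars of the smaller algebra. -/
def smulHom (m : M) : K →ₗ[ℤ] M :=
  ((LinearMap.toSpanSingleton A M m).toAddMonoidHom.comp
    φ.toAlgHom.toRingHom.toAddMonoidHom).toIntLinearMap

theorem smulHom_apply (m : M) (k : K) : φ.smulHom M m k = φ.toAlgHom k • m := rfl

variable {M} in
theorem δ_smul_of_cycle {z : M} (hz : M.δ z = 0) (a : A) : M.δ (a • z) = A.d a • z := by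
  induction a using A.induction_homogeneous with
  | h0 => simp
  | add x y hx hy => simp [add_smul, hx, hy]
  | hom i a ha => rw [M.leibniz ha, hz]; simp

variable {M}

theorem gradedProj_smul {n : ℤ} {z : M} (hz : z ∈ M.grading n) (i : ℤ) (k : K) :
    gradedProj M.grading i (φ.toAlgHom k • z) =
      φ.toAlgHom (DirectSum.decompose K.grading k (i - n)) • z := by
  induction k using K.induction_homogeneous with
  | h0 => simp
  | add x y hx hy => simp [add_smul, hx, hy]
  | hom j k hk =>
    have h' := M.smul_mem (φ.map_mem hk) hz
    by_cases h : j = i - n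
    · subst h
      rw [sub_add_cancel] at h'
      rw [gradedProj_of_mem _ h', DirectSum.decompose_of_mem_same _ hk]
    · rw [gradedProj_apply, DirectSum.decompose_of_mem_ne _ h' (by omega),
        DirectSum.decompose_of_mem_ne _ hk h, map_zero, zero_smul]

theorem range_smulHom_mem {n : ℤ} {z : M} (hz : z ∈ M.grading n) (hd : M.δ z = 0) :
    LinearMap.range (φ.smulHom M z) ∈ stableSubmodules ℤ (φ.operators M) := by
  rintro _ ((rfl | ⟨i, rfl⟩) | ⟨a, rfl⟩) _ ⟨k, rfl⟩
  · exact ⟨K.d k, by rw [smulHom_apply, smulHom_apply, δ_smul_of_cycle hd, φ.map_d]⟩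
  · exact ⟨_, (φ.gradedProj_smul hz i k).symm⟩
  · exact ⟨a * k, by simp [smulHom_apply, mul_smul]⟩

/-- For a stable `N` inside `K z`, the scalars carrying `z` into `N` form a left ideal. It is
homogeneous because `z` is, and `d`-stable because `δ (k z) = d k • z` for a cycle `z`; hence it is
`0` or `K`. -/
theorem isAtom_range_smulHom (hK : K.IsDGDivision) {n : ℤ} {z : M} (hz : z ∈ M.grading n)
    (hd : M.δ z = 0) (h0 : (⟨_, φ.range_smulHom_mem hz hd⟩ :
      stableSubmodules ℤ (φ.operators M)) ≠ ⊥) :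
    IsAtom (⟨_, φ.range_smulHom_mem hz hd⟩ : stableSubmodules ℤ (φ.operators M)) := by
  refine stableSubmodules.isAtom_iff.2 ⟨fun h => h0 (Subtype.ext h), fun N hN hle => ?_⟩
  let I : Submodule K K :=
    { N.toAddSubgroup.comap (φ.smulHom M z).toAddMonoidHom with
      smul_mem' := fun a k hk => by
        have := hN _ (.inr ⟨a, rfl⟩) _ hk
        change φ.smulHom M z _ ∈ N
        rw [smulHom_apply, smul_eq_mul, map_mul, mul_smul]
        exact this }
  have hmem (k : K) : k ∈ I ↔ φ.toAlgHom k • z ∈ N := Iff.rfl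
  have hI : K.IsDGLeftIdeal I := by
    refine ⟨fun k hk i => ?_, fun k hk => ?_⟩
    -- The component of `k` in degree `i` appears in degree `i + n` of `k z`, since `z` has degree
    -- `n`.
    · have := hN _ (.inl (.inr ⟨i + n, rfl⟩)) _ ((hmem k).1 hk)
      rw [φ.gradedProj_smul hz, add_sub_cancel_right] at this
      exact this
    · have := hN _ (.inl (.inl rfl)) _ ((hmem k).1 hk)
      rw [δ_smul_of_cycle hd, ← φ.map_d] at this
      exact this
  rcases hK.1 I hI with h | h
  · left
    rw [eq_bot_iff]
    intro m hm
    obtain ⟨k, rfl⟩ := hle hm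
    have hk : k ∈ I := hm
    rw [h, Submodule.mem_bot] at hk
    simp [hk]
  · right
    refine le_antisymm hle ?_
    rintro _ ⟨k, rfl⟩
    exact (hmem k).1 (h ▸ Submodule.mem_top)

variable (M) in
/-- Dg-modules over an acyclic dg-division algebra are semisimple. -/
theorem complementedLattice (hK : K.IsDGDivision) (hac : K.IsAcyclic) :
    ComplementedLattice (stableSubmodules ℤ (φ.operators M)) := by
  apply complementedLattice_of_sSup_atoms_eq_top
  obtain ⟨y, hy, hd⟩ := hac.exists_d_eq_one
  have hφd : A.d (φ.toAlgHom y) = 1 := by rw [← φ.map_d, hd, map_one]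
  have key (n : ℤ) (z : M) (hz : z ∈ M.grading n) (hz0 : M.δ z = 0) (k : K) :
      φ.toAlgHom k • z ∈ ((sSup {N : stableSubmodules ℤ (φ.operators M) | IsAtom N} :
        stableSubmodules ℤ (φ.operators M)) : Submodule ℤ M) :=
    stableSubmodules.le_sSup_atoms (φ.isAtom_range_smulHom hK hz hz0) ⟨k, rfl⟩
  refine stableSubmodules.sSup_atoms_eq_top_of_forall_mem fun m => ?_
  induction m using homogeneous_induction M.grading with
  | h0 => exact zero_mem _
  | add x y hx hy => exact add_mem hx hy
  | hom i m hm =>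
    -- Both `δ (y m)` and `δ m` are homogeneous cycles; they are taken with the scalars `1` and `y`.
    rw [homotopy (φ.map_mem hy) hφd M m]
    refine add_mem ?_ (key _ _ (M.δ_mem hm) (M.δ_δ m) y)
    have := key _ _ (M.δ_mem (M.smul_mem (φ.map_mem hy) hm)) (M.δ_δ _) 1
    rwa [map_one, one_smul] at this

/-! ### Averaging over the tensor product -/

variable (h : M →ₗ[ℤ] M) (hK : ∀ (k : K) (m : M), h (φ.toAlgHom k • m) = φ.toAlgHom k • h m)

/-- The additive map `B ⊗_R B → M`, `b₁ ⊗ b₂ ↦ b₁ h (b₂ m)`. -/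
def averageAux (m : M) : A ⊗[R] A →+ M :=
  TensorProduct.liftAddHom
    (AddMonoidHom.mk' (fun b₁ : A => (AddMonoidHom.mk' (fun b₂ : A => b₁ • h (b₂ • m))
      fun x y => by simp [add_smul])) fun x y => by ext; simp [add_smul])
    fun r b₁ b₂ => by
      -- `h` is only additive by type; it commutes with scalars from `R` because these act through
      -- `K`.
      have := hK (algebraMap R K r) (b₂ • m)
      simp only [AlgHom.commutes] at this
      simp only [AddMonoidHom.mk'_apply, Algebra.smul_def r b₂, mul_smul, this]
      rw [← mul_smul, ← Algebra.commutes, ← Algebra.smul_def]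

theorem averageAux_tmul (m : M) (b₁ b₂ : A) :
    φ.averageAux h hK m (b₁ ⊗ₜ[R] b₂) = b₁ • h (b₂ • m) := rfl

theorem averageAux_of_mem_relations (m : M) {t : A ⊗[R] A} (ht : t ∈ φ.relations) :
    φ.averageAux h hK m t = 0 := by
  induction ht using Submodule.closure_induction with
  | zero => exact map_zero _
  | add x y _ _ hx hy => rw [map_add, hx, hy, add_zero]
  | smul_mem r t ht =>
    obtain ⟨b₁, b₂, a, rfl⟩ := ht
    rw [smul_sub, TensorProduct.smul_tmul', TensorProduct.smul_tmul', map_sub, averageAux_tmul,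
      averageAux_tmul, ← smul_mul_assoc, mul_smul, mul_smul, hK, sub_self]

/-- The additive map `B ⊗_A B → M`, `b₁ ⊗ b₂ ↦ b₁ h (b₂ m)`. -/
def average (m : M) : φ.Tensor →+ M :=
  QuotientAddGroup.lift φ.relations.toAddSubgroup (φ.averageAux h hK m)
    fun _ ht => φ.averageAux_of_mem_relations h hK m ht

theorem average_tmul (m : M) (b₁ b₂ : A) :
    φ.average h hK m (φ.tmul b₁ b₂) = b₁ • h (b₂ • m) := rfl

variable {φ} in
theorem tensor_induction {p : φ.Tensor → Prop} (h0 : p 0) (tmul : ∀ b₁ b₂ : A, p (φ.tmul b₁ b₂))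
    (add : ∀ s t, p s → p t → p (s + t)) (t : φ.Tensor) : p t := by
  obtain ⟨t, rfl⟩ := φ.relations.mkQ_surjective t
  induction t using TensorProduct.induction_on with
  | zero => simpa using h0
  | tmul b₁ b₂ => exact tmul b₁ b₂
  | add s t hs ht => rw [map_add]; exact add _ _ hs ht

variable {φ} in
theorem tensorGrading_induction {n : ℤ} {p : ∀ t : φ.Tensor, t ∈ φ.tensorGrading n → Prop}
    (h0 : p 0 (zero_mem _))
    (tmul : ∀ (i j : ℤ) (b₁ b₂ : A), b₁ ∈ A.grading i → b₂ ∈ A.grading j → i + j = n →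
      ∀ h, p (φ.tmul b₁ b₂) h)
    (add : ∀ s t hs ht, p s hs → p t ht → p (s + t) (add_mem hs ht)) {t : φ.Tensor}
    (ht : t ∈ φ.tensorGrading n) : p t ht := by
  induction ht using Submodule.closure_induction with
  | zero => exact h0
  | add x y _ _ hx hy => exact add _ _ _ _ hx hy
  -- The scalar is absorbed into `b₁`, so that additive predicates suffice.
  | smul_mem r t ht =>
    obtain ⟨i, j, b₁, b₂, hb₁, hb₂, hij, rfl⟩ := ht
    exact tmul i j (r • b₁) b₂ ((A.grading i).smul_mem r hb₁) hb₂ hij _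

theorem average_lmul (m : M) (b : A) (t : φ.Tensor) :
    φ.average h hK m (φ.lmul b t) = b • φ.average h hK m t := by
  induction t using tensor_induction with
  | h0 => simp
  | add s t hs ht => simp only [map_add, smul_add, hs, ht]
  | tmul b₁ b₂ => exact mul_smul b b₁ _

theorem average_rmul (m : M) (b : A) (t : φ.Tensor) :
    φ.average h hK m (φ.rmul b t) = φ.average h hK (b • m) t := by
  induction t using tensor_induction with
  | h0 => simp
  | add s t hs ht => simp only [map_add, hs, ht]
  | tmul b₁ b₂ =>
    change b₁ • h ((b₂ * b) • m) = b₁ • h (b₂ • b • m)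
    rw [mul_smul]

theorem average_add (m m' : M) (t : φ.Tensor) :
    φ.average h hK (m + m') t = φ.average h hK m t + φ.average h hK m' t := by
  induction t using tensor_induction with
  | h0 => simp
  | add s t hs ht => simp only [map_add, hs, ht]; abel
  | tmul b₁ b₂ => simp [average_tmul]

/-- On the submodule that `h` fixes, averaging is multiplication by `mulMap t`, which is `1` for `t
= ρ 1`. -/
theorem average_of_forall_smul (m : M) (hm : ∀ b : A, h (b • m) = b • m) (t : φ.Tensor) :
    φ.average h hK m t = φ.mulMap t • m := by
  induction t using tensor_induction with
  | h0 => simp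
  | add s t hs ht => simp only [map_add, add_smul, hs, ht]
  | tmul b₁ b₂ =>
    rw [average_tmul, hm, ← mul_smul]
    rfl

theorem average_mem {N : Submodule A M} (hN : ∀ m, h m ∈ N) (m : M) (t : φ.Tensor) :
    φ.average h hK m t ∈ N := by
  induction t using tensor_induction with
  | h0 => simp
  | add s t hs ht => rw [map_add]; exact N.add_mem hs ht
  | tmul b₁ b₂ => exact N.smul_mem _ (hN _)

theorem average_mem_grading (hdeg : ∀ i, ∀ m ∈ M.grading i, h m ∈ M.grading i) {n : ℤ}
    {t : φ.Tensor} (ht : t ∈ φ.tensorGrading n) {i : ℤ} {m : M} (hm : m ∈ M.grading i) :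
    φ.average h hK m t ∈ M.grading (n + i) := by
  induction ht using tensorGrading_induction with
  | h0 => simp
  | add s t _ _ hs ht => rw [map_add]; exact add_mem hs ht
  | tmul j k b₁ b₂ hb₁ hb₂ hjk _ =>
    rw [← hjk, add_assoc]
    exact M.smul_mem hb₁ (hdeg _ _ (M.smul_mem hb₂ hm))

/-- Moving `δ` past `b₁` and then `b₂` costs `(-1) ^ (|b₁| + |b₂|)`, which is `1` in total degree
`0`. If also `tensorD t = 0`, averaging commutes with `δ`. -/
theorem δ_average (hδ : ∀ m, h (M.δ m) = M.δ (h m)) {t : φ.Tensor}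
    (ht : t ∈ φ.tensorGrading 0) (m : M) :
    M.δ (φ.average h hK m t) =
      φ.average h hK m (φ.tensorD t) + φ.average h hK (M.δ m) t := by
  induction ht using tensorGrading_induction with
  | h0 => simp
  | add s t _ _ hs ht => simp only [map_add, hs, ht]; abel
  | tmul i j b₁ b₂ hb₁ hb₂ hij _ =>
    have hD : φ.tensorD (φ.tmul b₁ b₂) =
        φ.tmul (A.d b₁) b₂ + φ.tmul (A.sign b₁) (A.d b₂) := rfl
    have hsign : i.negOnePow * j.negOnePow = 1 := by
      rw [← Int.negOnePow_add, hij, Int.negOnePow_zero]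
    rw [hD, map_add, average_tmul, average_tmul, average_tmul, average_tmul, A.sign_of_mem hb₁,
      M.leibniz hb₁, ← hδ, M.leibniz hb₂]
    simp only [Units.smul_def, map_add, map_zsmul, smul_add, smul_assoc]
    rw [smul_comm b₁ (j.negOnePow : ℤ), ← mul_smul, ← Units.val_mul, hsign]
    simp [add_assoc]

variable (M) in
/-- For a dg-separable extension of an acyclic dg-division algebra, every dg-submodule is the image
of an idempotent endomorphism. -/
theorem exists_dg_projection (hdiv : K.IsDGDivision) (hac : K.IsAcyclic) (hφ : φ.IsDGSeparable)
    {N : Submodule A M} (hN : M.IsDGSubmodule N) :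
    ∃ π : M ⟶ M, (∀ m, π.toLinearMap m ∈ N) ∧ ∀ n ∈ N, π.toLinearMap n = n := by
  have := φ.complementedLattice M hdiv hac
  have hN' : N.toAddSubgroup.toIntSubmodule ∈ stableSubmodules ℤ (φ.operators M) := by
    rintro f (hf | ⟨k, rfl⟩) m hm
    · exact M.mem_stableSubmodules_operators.2 hN f hf m hm
    · exact N.smul_mem _ hm
  obtain ⟨h, hmem, hid, hcomm⟩ := stableSubmodules.exists_projection hN'
  have hK (k : K) (m : M) : h (φ.toAlgHom k • m) = φ.toAlgHom k • h m :=
    hcomm _ (.inr ⟨k, rfl⟩) m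
  have hδ (m : M) : h (M.δ m) = M.δ (h m) := hcomm _ (.inl (.inl rfl)) m
  have hdeg (i : ℤ) (m : M) (hm : m ∈ M.grading i) : h m ∈ M.grading i :=
    mem_of_gradedProj_comm M.grading (h := h.toAddMonoidHom) (hcomm _ (.inl (.inr ⟨i, rfl⟩))) hm
  obtain ⟨ρ, hl, hr, hgr, hd, hmul⟩ := hφ
  have hgr1 : ρ 1 ∈ φ.tensorGrading 0 := hgr 0 1 SetLike.GradedOne.one_mem
  refine ⟨⟨{ toFun m := φ.average h hK m (ρ 1), map_add' := ?_, map_smul' := ?_ }, ?_, ?_⟩,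
    fun m => ?_, fun n hn => ?_⟩
  · exact fun m m' => φ.average_add h hK m m' _
  · intro b m
    -- Linearity over `A` is the centrality of `ρ 1`: both `ρ 1 · b` and `b · ρ 1` equal `ρ b`.
    rw [← average_rmul, ← hr, one_mul, RingHom.id_apply, ← average_lmul, ← hl, mul_one]
  · intro i m hm
    have := φ.average_mem_grading h hK hdeg hgr1 hm
    rwa [zero_add] at this
  · intro m
    have := φ.δ_average h hK hδ hgr1 m
    -- `ρ 1` is a cycle because `d 1 = 0`.
    rw [← hd, A.d_one, map_zero, map_zero, zero_add] at this
    exact this.symm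
  · exact φ.average_mem h hK hmem m _
  · have := φ.average_of_forall_smul h hK n (fun b => hid _ (N.smul_mem b hn)) (ρ 1)
    rw [hmul, one_smul] at this
    exact this

end Extension

end DGAlgebra

/-! ### Categories of dg-modules in which all dg-submodules are retracts -/

namespace DGModule

variable {R : Type u₀} [CommRing R] {A : DGAlgebra.{u₀, u} R}

/-- Every dg-submodule is the image of an endomorphism that restricts to the identity on it. -/
def HasProjections (A : DGAlgebra.{u₀, u} R) : Prop :=
  ∀ (M : DGModule.{u₀, u, v} A) (N : Submodule A M), M.IsDGSubmodule N →
    ∃ π : M ⟶ M, (∀ m, π.toLinearMap m ∈ N) ∧ ∀ n ∈ N, π.toLinearMap n = n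

theorem gradedProj_hom {M N : DGModule.{u₀, u, v} A} (f : M ⟶ N) (i : ℤ) (m : M) :
    gradedProj N.grading i (f.toLinearMap m) = f.toLinearMap (gradedProj M.grading i m) := by
  have := gradedProj_comm_of_mem M.grading N.grading (f := f.toLinearMap.toAddMonoidHom) (n := 0)
    (fun i m hm => by rw [add_zero]; exact f.map_mem i m hm) i m
  rwa [add_zero] at this

theorem isDGSubmodule_ker {M N : DGModule.{u₀, u, v} A} (f : M ⟶ N) :
    M.IsDGSubmodule (LinearMap.ker f.toLinearMap) := by
  refine ⟨fun m hm i => ?_, fun m hm => ?_⟩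
  · rw [LinearMap.mem_ker] at hm ⊢
    rw [← gradedProj_apply, ← gradedProj_hom, hm, map_zero]
  · rw [LinearMap.mem_ker] at hm ⊢
    rw [f.map_δ, hm, map_zero]

theorem isDGSubmodule_range {M N : DGModule.{u₀, u, v} A} (f : M ⟶ N) :
    N.IsDGSubmodule (LinearMap.range f.toLinearMap) := by
  refine ⟨?_, ?_⟩
  · rintro _ ⟨m, rfl⟩ i
    exact ⟨_, (gradedProj_hom f i m).symm⟩
  · rintro _ ⟨m, rfl⟩
    exact ⟨_, f.map_δ m⟩

namespace HasProjections

/-- The projection onto the range and the identity agree after composition with `p`, hence coincide.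
-/
theorem surjective_of_epi (hA : HasProjections.{u₀, u, v} A)
    {M N : DGModule.{u₀, u, v} A} (p : M ⟶ N) [Epi p] :
    Function.Surjective p.toLinearMap := by
  obtain ⟨π, hmem, hid⟩ := hA N _ (isDGSubmodule_range p)
  have h : p ≫ π = p ≫ 𝟙 N := Hom.ext (LinearMap.ext fun m => hid _ ⟨m, rfl⟩)
  rw [cancel_epi] at h
  intro n
  have := hmem n
  rw [h] at this
  exact this

/-- With `π` a projection onto `ker p`, the map `1 - π` kills `ker p`. It thus descends along `p` to
a section, independent of the chosen preimages. -/
theorem exists_section (hA : HasProjections.{u₀, u, v} A)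
    {M N : DGModule.{u₀, u, v} A} (p : M ⟶ N) [Epi p] :
    ∃ s : N ⟶ M, s ≫ p = 𝟙 N := by
  have hp := hA.surjective_of_epi p
  obtain ⟨π, hmem, hid⟩ := hA M _ (isDGSubmodule_ker p)
  have key {x y : M} (hxy : p.toLinearMap x = p.toLinearMap y) :
      x - π.toLinearMap x = y - π.toLinearMap y := by
    have := hid (x - y) (by rw [LinearMap.mem_ker, map_sub, hxy, sub_self])
    rw [map_sub] at this
    rw [sub_eq_sub_iff_sub_eq_sub, this]
  choose q hq using hp
  have hs {x : M} {n : N} (hx : p.toLinearMap x = n) :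
      q n - π.toLinearMap (q n) = x - π.toLinearMap x := key (by rw [hq, hx])
  refine ⟨⟨{ toFun n := q n - π.toLinearMap (q n), map_add' := ?_, map_smul' := ?_ }, ?_, ?_⟩, ?_⟩
  · intro x y
    rw [hs (x := q x + q y) (by rw [map_add, hq, hq]), map_add]
    abel
  · intro a x
    rw [hs (x := a • q x) (by rw [map_smul, hq]), map_smul, RingHom.id_apply, smul_sub]
  · intro i n hn
    have h : p.toLinearMap (gradedProj M.grading i (q n)) = n := by
      rw [← gradedProj_hom, hq, gradedProj_of_mem _ hn]
    have hi := gradedProj_mem M.grading i (q n)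
    change q n - π.toLinearMap (q n) ∈ _
    rw [hs h]
    exact sub_mem hi (π.map_mem _ _ hi)
  · intro n
    change q _ - π.toLinearMap (q _) = M.δ (q n - π.toLinearMap (q n))
    rw [hs (x := M.δ (q n)) (by rw [p.map_δ, hq]), map_sub, π.map_δ]
  · refine Hom.ext (LinearMap.ext fun n => ?_)
    change p.toLinearMap (q n - π.toLinearMap (q n)) = n
    rw [map_sub, hq, LinearMap.mem_ker.1 (hmem (q n)), sub_zero]

theorem projective (hA : HasProjections.{u₀, u, v} A)
    (M : DGModule.{u₀, u, v} A) : Projective M where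
  factors f e _ := by
    obtain ⟨s, hs⟩ := hA.exists_section e
    exact ⟨f ≫ s, by rw [Category.assoc, hs, Category.comp_id]⟩

theorem isSemisimpleCategory (hA : HasProjections.{u₀, u, v} A) :
    IsSemisimpleCategory (DGModule.{u₀, u, v} A) := by
  intro S hS
  -- A section of `f` is a two-sided inverse once `f` is mono: cancel `f` in `f ≫ s ≫ f = f`.
  have : Balanced (DGModule.{u₀, u, v} A) := ⟨fun f _ _ => by
    obtain ⟨s, hs⟩ := hA.exists_section f
    exact ⟨s, by rw [← cancel_mono f, Category.assoc, hs, Category.comp_id, Category.id_comp], hs⟩⟩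
  have := hS.epi_g
  obtain ⟨s, hs⟩ := hA.exists_section S.g
  exact ⟨.ofExactOfSection S hS.exact s hs hS.mono_f⟩

theorem isDirectSumOfSimples (hA : HasProjections.{u₀, u, v} A)
    (M : DGModule.{u₀, u, v} A) : M.IsDirectSumOfSimples := by
  have : ComplementedLattice (stableSubmodules A M.operators) := ⟨fun ⟨N, hN⟩ => by
    obtain ⟨π, hmem, hid⟩ := hA M N (M.mem_stableSubmodules_operators.1 hN)
    -- The complement of `N` is the kernel of the projection onto it.
    refine ⟨⟨_, M.mem_stableSubmodules_operators.2 (isDGSubmodule_ker π)⟩, ?_⟩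
    have hc := LinearMap.isCompl_of_proj (p := N) (f := π.toLinearMap.codRestrict N hmem)
      fun x => Subtype.ext (hid x x.2)
    rw [LinearMap.ker_codRestrict, isCompl_iff, disjoint_iff, codisjoint_iff] at hc
    rw [isCompl_iff, disjoint_iff, codisjoint_iff]
    exact ⟨Subtype.ext hc.1, Subtype.ext hc.2⟩⟩
  exact M.isDirectSumOfSimples_of_complementedLattice

end HasProjections

end DGModule

theorem DGAlgebra.Extension.hasProjections {R : Type u₀} [CommRing R] {K : DGAlgebra.{u₀, u'} R}
    {A : DGAlgebra.{u₀, u} R} (φ : DGAlgebra.Extension K A) (hdiv : K.IsDGDivision)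
    (hac : K.IsAcyclic) (hφ : φ.IsDGSeparable) : DGModule.HasProjections.{u₀, u, v} A :=
  fun M _ hN => φ.exists_dg_projection M hdiv hac hφ hN

/-! ### Graded modules over the cycles -/

namespace DGAlgebra

variable {R : Type u₀} [CommRing R] (A : DGAlgebra.{u₀, u} R)

instance regularDecomposition :
    DirectSum.Decomposition fun i => (A.grading i).toAddSubgroup where
  decompose' a := DirectSum.decompose A.grading a
  left_inv := DirectSum.Decomposition.left_inv (ℳ := A.grading)
  right_inv := DirectSum.Decomposition.right_inv (ℳ := A.grading)

/-- A dg-algebra as a left dg-module over itself. -/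
def regular : DGModule.{u₀, u, u} A where
  carrier := A
  grading i := (A.grading i).toAddSubgroup
  smul_mem ha hm := SetLike.mul_mem_graded ha hm
  δ := A.d.toAddMonoidHom
  δ_mem := A.d_mem
  δ_δ := A.d_d
  leibniz := A.leibniz

variable {A}

variable (A) in
/-- The differential with values in the cycles. -/
def dCycles : A →+ A.cycles where
  toFun a := ⟨A.d a, A.d_d a⟩
  map_zero' := Subtype.ext (map_zero _)
  map_add' a b := Subtype.ext (map_add _ a b)

theorem coe_dCycles (a : A) : (A.dCycles a : A) = A.d a := rfl

theorem dCycles_mul_of_cycle (a : A) (z : A.cycles) : A.dCycles (a * z) = A.dCycles a * z := by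
  have hz : A.d z = 0 := z.2
  refine Subtype.ext ?_
  simp [coe_dCycles, A.d_mul, hz]

theorem coe_decompose_cycles (z : A.cycles) (i : ℤ) :
    ((DirectSum.decompose A.cyclesGrading z i : A.cycles) : A) =
      DirectSum.decompose A.grading (z : A) i := by
  induction z using DirectSum.Decomposition.inductionOn A.cyclesGrading with
  | zero => simp
  | add x y hx hy => simp [DirectSum.decompose_add, hx, hy]
  | @homogeneous j z =>
    have hz : ((z : A.cycles) : A) ∈ A.grading j := z.2
    by_cases h : j = i
    · subst h
      rw [DirectSum.decompose_of_mem_same _ hz, DirectSum.decompose_of_mem_same _ z.2]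
    · rw [DirectSum.decompose_of_mem_ne _ hz h, DirectSum.decompose_of_mem_ne _ z.2 h]
      rfl

theorem decompose_dCycles (a : A) (i : ℤ) :
    (DirectSum.decompose A.cyclesGrading (A.dCycles a) (i + 1) : A.cycles) =
      A.dCycles (DirectSum.decompose A.grading a i) :=
  Subtype.ext (by rw [coe_decompose_cycles, coe_dCycles, A.decompose_d, coe_dCycles])

/-- The dg-left ideal generated by a left ideal `J` of the cycles; if `A` is acyclic, then it
consists of all `a` such that `d (b a) ∈ J` for all `b`. -/
def extendIdeal (J : Submodule A.cycles A.cycles) : Submodule A A where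
  carrier := {a | ∀ b : A, A.dCycles (b * a) ∈ J}
  zero_mem' b := by simp
  add_mem' ha ha' b := by
    rw [mul_add, map_add]
    exact J.add_mem (ha b) (ha' b)
  smul_mem' c a ha b := by
    rw [smul_eq_mul, ← mul_assoc]
    exact ha _

theorem isDGLeftIdeal_extendIdeal {J : Submodule A.cycles A.cycles}
    (hJ : ∀ z ∈ J, ∀ i, (DirectSum.decompose A.cyclesGrading z i : A.cycles) ∈ J) :
    A.IsDGLeftIdeal (extendIdeal J) := by
  refine ⟨fun a ha i b => ?_, fun a ha b => ?_⟩
  · induction b using A.induction_homogeneous with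
    | h0 => simp
    | add x y hx hy => rw [add_mul, map_add]; exact J.add_mem hx hy
    | hom j b hb =>
      -- For `b` of degree `j`, the part of `d (b a)` in degree `j + i + 1` is `d (b aᵢ)`.
      have h := hJ _ (ha b) (j + i + 1)
      rwa [decompose_dCycles, DirectSum.coe_decompose_mul_add_of_left_mem _ hb] at h
  -- `d (b (d a)) = d b * d a`, and `d a` is in `J` by the condition at `b = 1`.
  · have h := J.smul_mem (A.dCycles b) (ha 1)
    rw [one_mul, smul_eq_mul, ← dCycles_mul_of_cycle] at h
    exact h

theorem coe_mem_extendIdeal {J : Submodule A.cycles A.cycles} {z : A.cycles} (hz : z ∈ J) :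
    (z : A) ∈ extendIdeal J := fun b => by
  rw [dCycles_mul_of_cycle]
  exact J.smul_mem _ hz

theorem eq_d_mul_add {y : A} (hy : y ∈ A.grading (-1)) (hd : A.d y = 1) (a : A) :
    a = A.d (y * a) + y * A.d a :=
  homotopy hy hd A.regular a

/-- Shows that a cycle lying in `extendIdeal J` already lies in `J`: test the condition at `b = y`.
-/
theorem dCycles_mul_coe {y : A} (hd : A.d y = 1) (z : A.cycles) : A.dCycles (y * z) = z := by
  rw [dCycles_mul_of_cycle]
  exact Subtype.ext (by simp [coe_dCycles, hd])

/-- In `a = d (y a) + y (d a)`, both `d (y a)` and `d a` lie in `J`. -/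
theorem extendIdeal_le {y : A} (hy : y ∈ A.grading (-1)) (hd : A.d y = 1)
    {J : Submodule A.cycles A.cycles} {I : Submodule A A} (hJI : ∀ z ∈ J, (z : A) ∈ I) :
    extendIdeal J ≤ I := fun a ha => by
  rw [eq_d_mul_add hy hd a]
  have h := hJI _ (ha 1)
  rw [one_mul] at h
  exact I.add_mem (hJI _ (ha y)) (I.smul_mem y h)

end DGAlgebra

/-! ### Gr-simple modules over the cycles, obtained from simple dg-left ideals. -/

namespace GrModule

variable {R : Type u₀} [CommRing R] {A : DGAlgebra.{u₀, u} R}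

section

variable {S : Type u} [Ring S] [Algebra R S] {𝒮 : ℤ → Submodule R S} (V : GrModule.{u₀, u, w} 𝒮)

/-- The projections to the homogeneous components. -/
def operators : Set (V →+ V) := Set.range (gradedProj V.grading)

theorem mem_stableSubmodules_operators {N : Submodule S V} :
    N ∈ stableSubmodules S V.operators ↔ V.IsGrSubmodule N := by
  rw [mem_stableSubmodules]
  refine ⟨fun h m hm i => h _ ⟨i, rfl⟩ m hm, ?_⟩
  rintro h _ ⟨i, rfl⟩ m hm
  exact h m hm i

theorem isDirectSumOfSimples_of_sSup_atoms
    (h : sSup {N : stableSubmodules S V.operators | IsAtom N} = ⊤) : V.IsDirectSumOfSimples := by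
  obtain ⟨s, hs, hind, htop⟩ := stableSubmodules.exists_direct_sum h
  exact ⟨s, fun N hN => ⟨V.mem_stableSubmodules_operators.1 (hs N hN).1, (hs N hN).2.1,
    fun P hP => (hs N hN).2.2 P (V.mem_stableSubmodules_operators.2 hP)⟩, hind, htop⟩

end

variable (V : GrModule.{u₀, u, w} A.cyclesGrading)

/-- The submodule of all `z • v` with `z` a cycle in the left ideal `I`. -/
def cyclesSMul (I : Submodule A A) (v : V) : Submodule A.cycles V where
  carrier := {x | ∃ z : A.cycles, (z : A) ∈ I ∧ z • v = x}
  zero_mem' := ⟨0, I.zero_mem, zero_smul _ _⟩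
  add_mem' := by
    rintro _ _ ⟨z, hz, rfl⟩ ⟨z', hz', rfl⟩
    exact ⟨z + z', I.add_mem hz hz', add_smul _ _ _⟩
  smul_mem' := by
    rintro a _ ⟨z, hz, rfl⟩
    exact ⟨a * z, I.smul_mem (a : A) hz, mul_smul _ _ _⟩

/-- The left ideal of all cycles `z` in `I` with `z • v ∈ N`. -/
def cyclesColon (I : Submodule A A) (v : V) (N : Submodule A.cycles V) :
    Submodule A.cycles A.cycles where
  carrier := {z | (z : A) ∈ I ∧ z • v ∈ N}
  zero_mem' := ⟨I.zero_mem, by simp⟩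
  add_mem' h h' := ⟨I.add_mem h.1 h'.1, by rw [add_smul]; exact N.add_mem h.2 h'.2⟩
  smul_mem' a z h := ⟨I.smul_mem (a : A) h.1, by
    rw [smul_eq_mul, mul_smul]; exact N.smul_mem _ h.2⟩

variable {V} {I : Submodule A A} {n : ℤ} {v : V}

theorem cyclesSMul_mem (hI : A.IsDGLeftIdeal I) (hv : v ∈ V.grading n) :
    V.cyclesSMul I v ∈ stableSubmodules A.cycles V.operators := by
  rintro _ ⟨i, rfl⟩ _ ⟨z, hz, rfl⟩
  refine ⟨_, ?_, (by simpa using (gradedProj_smul V.grading A.cyclesGrading V.smul_mem hv (i - n)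
    z).symm)⟩
  rw [DGAlgebra.coe_decompose_cycles]
  exact hI.1 _ hz _

/-- A graded `N` inside `(I ∩ ker d) v` is determined by its colon ideal `J` in `I ∩ ker d`. The
dg-left ideal `extendIdeal J` lies in the simple `I`, so it is `0` or `I`, and `J` is accordingly
`0` or `I ∩ ker d`. -/
theorem isAtom_cyclesSMul {y : A} (hy : y ∈ A.grading (-1)) (hd : A.d y = 1)
    (hI : A.regular.IsSimpleDGSubmodule I) (hv : v ∈ V.grading n)
    (h0 : (⟨_, cyclesSMul_mem hI.1 hv⟩ : stableSubmodules A.cycles V.operators) ≠ ⊥) :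
    IsAtom (⟨_, cyclesSMul_mem hI.1 hv⟩ : stableSubmodules A.cycles V.operators) := by
  refine stableSubmodules.isAtom_iff.2 ⟨fun h => h0 (Subtype.ext h), fun N hN hle => ?_⟩
  have hJ : ∀ z ∈ V.cyclesColon I v N, ∀ i,
      (DirectSum.decompose A.cyclesGrading z i : A.cycles) ∈ V.cyclesColon I v N := by
    refine fun z hz i => ⟨?_, ?_⟩
    · rw [DGAlgebra.coe_decompose_cycles]
      exact hI.1.1 _ hz.1 i
    · rw [← gradedProj_smul V.grading A.cyclesGrading V.smul_mem hv]
      exact hN _ ⟨i + n, rfl⟩ _ hz.2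
  rcases hI.2.2 _ (DGAlgebra.isDGLeftIdeal_extendIdeal hJ)
    (DGAlgebra.extendIdeal_le hy hd fun z hz => hz.1) with h | h
  · left
    rw [eq_bot_iff]
    intro x hx
    obtain ⟨z, hz, rfl⟩ := hle hx
    have := DGAlgebra.coe_mem_extendIdeal (J := V.cyclesColon I v N) (z := z) ⟨hz, hx⟩
    have hz0 : (z : A) = 0 := by
      rw [h] at this
      exact this
    rw [show z = 0 from Subtype.ext hz0, zero_smul]
    exact zero_mem _
  · right
    refine le_antisymm hle ?_
    rintro _ ⟨z, hz, rfl⟩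
    have hz' : (z : A) ∈ DGAlgebra.extendIdeal (V.cyclesColon I v N) := by
      rw [h]
      exact hz
    have := hz' y
    rw [DGAlgebra.dCycles_mul_coe hd] at this
    exact this.2

end GrModule

/-- If an acyclic dg-algebra is a sum of simple dg-left ideals, then its cycles are
graded-semisimple. -/
theorem DGAlgebra.isGradedSemisimple_cycles {R : Type u₀} [CommRing R] {A : DGAlgebra.{u₀, u} R}
    (hA : A.IsAcyclic) (h : A.regular.IsDirectSumOfSimples) :
    IsGradedSemisimple.{u₀, u, w} A.cyclesGrading := by
  intro V
  obtain ⟨y, hy, hd⟩ := hA.exists_d_eq_one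
  obtain ⟨s, hs, -, htop⟩ := h
  refine V.isDirectSumOfSimples_of_sSup_atoms
    (stableSubmodules.sSup_atoms_eq_top_of_forall_mem fun v => ?_)
  induction v using homogeneous_induction V.grading with
  | h0 => exact zero_mem _
  | add x y hx hy => exact add_mem hx hy
  | hom n v hv =>
    have key (a : A) (ha : a ∈ sSup s) : A.dCycles a • v ∈
        ((sSup {N : stableSubmodules A.cycles V.operators | IsAtom N} :
          stableSubmodules A.cycles V.operators) : Submodule A.cycles V) := by
      rw [sSup_eq_iSup'] at ha
      refine Submodule.iSup_induction _ (motive := fun a => A.dCycles a • v ∈ _) ha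
        (fun I a haI => ?_) ?_ fun a b ha hb => ?_
      -- `I` is `d`-stable, so `d a` is a cycle in `I`.
      · exact stableSubmodules.le_sSup_atoms (GrModule.isAtom_cyclesSMul hy hd (hs I I.2) hv)
          ⟨_, (hs I I.2).1.2 a haI, rfl⟩
      · rw [map_zero, zero_smul]
        exact zero_mem _
      · rw [map_add, add_smul]
        exact add_mem ha hb
    have := key y (by rw [htop]; exact Submodule.mem_top (R := A) (M := A.regular))
    rwa [show A.dCycles y = 1 from Subtype.ext hd, one_smul] at this

theorem corollary4p4 {R : Type u₀} [CommRing R] (K : DGAlgebra.{u₀, u'} R)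
    (A : DGAlgebra.{u₀, u} R) (φ : DGAlgebra.Extension K A)
    (hK_comm : K.IsGradedCommutative) (hK_div : K.IsDGDivision) (hK_acyclic : K.IsAcyclic)
    (hA_acyclic : A.IsAcyclic) (hφ : φ.IsDGSeparable) :
    (∀ M : DGModule.{u₀, u, v} A, Projective M) ∧
      (A.IsDGArtinian → A.IsDGNoetherian →
        IsSemisimpleCategory (DGModule.{u₀, u, v} A) ∧
        (∀ M : DGModule.{u₀, u, v} A, M.IsDirectSumOfSimples) ∧
        IsGradedSemisimple.{u₀, u, w} A.cyclesGrading) := by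
  have hA := φ.hasProjections hK_div hK_acyclic hφ
  exact ⟨hA.projective, fun _ _ => ⟨hA.isSemisimpleCategory, hA.isDirectSumOfSimples,
    A.isGradedSemisimple_cycles hA_acyclic
      -- The regular module lives in the universe of `A`, so the projections are needed there as
      -- well as in universe `v`.
      ((φ.hasProjections hK_div hK_acyclic hφ).isDirectSumOfSimples A.regular)⟩⟩
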